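/- All graphs are finite and simple. For a graph $\Gamma$ with edge set $E$, a \emph{local antimagic labeling} of $\Gamma$ is a bijection $f:E\to\{1,2,\dots,|E|\}$ such that $f^+(u)\ne f^+(v)$ for every two adjacent vertices $u,v$, where $f^+(u)$ denotes the sum of $f(e)$ over all edges $e$ incident to $u$. The \emph{local antimagic chromatic number} $\chi_{la}(\Gamma)$ is the minimum, over all local antimagic labelings $f$ of $\Gamma$, of the number of distinct values of $f^+$. The \emph{lexicographic product} $G[H]$ has vertex set $V(G)\times V(H)$, and $(u,u')$, $(v,v')$ are adjacent if and only if either $uv\in E(G)$, or $u=v$ and $u'v'\in E(H)$. Let $m\ge 2$ and $n\ge 1$ be integers, let $G=C_3\times K_2$ be the Cartesian product of the triangle and the complete graph of order $2$ (the triangular prism), and let $H=C_{2m}\vee O_{2n}$ be the join of the cycle $C_{2m}$ of order $2m$ and the null (edgeless) graph $O_{2n}$ of order $2n$. Then $$\chi_{la}(G[H])=9 .$$ -/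

import Mathlib

namespace LocalAntimagic

/-- The lexicographic product `G[H]`: `(u, u')` and `(v, v')` are adjacent iff `u v` is an edge
of `G`, or `u = v` and `u' v'` is an edge of `H`. -/
def lexProd {V W : Type*} (G : SimpleGraph V) (H : SimpleGraph W) : SimpleGraph (V × W) where
  Adj x y := G.Adj x.1 y.1 ∨ (x.1 = y.1 ∧ H.Adj x.2 y.2)
  symm := ⟨fun _ _ h => h.imp (fun h => h.symm) (fun h => ⟨h.1.symm, h.2.symm⟩)⟩
  loopless := ⟨fun x h => h.elim (fun h => G.irrefl h) (fun h => H.irrefl h.2)⟩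

/-- The join `G ∨ H`: the disjoint union of `G` and `H` together with all the edges between a
vertex of `G` and a vertex of `H`. -/
def join {V W : Type*} (G : SimpleGraph V) (H : SimpleGraph W) : SimpleGraph (V ⊕ W) :=
  G.sum H ⊔ completeBipartiteGraph V W

open scoped Classical in
/-- The induced vertex label `f⁺(v)`: the sum of the labels of the edges incident to `v`. -/
noncomputable def vertexLabel {V : Type*} [Fintype V] (G : SimpleGraph V) (f : Sym2 V → ℕ)
    (v : V) : ℕ :=
  ∑ e ∈ G.incidenceFinset v, f e

/-- `f` restricts to a bijection from `E(G)` onto `{1, …, |E(G)|}` (its values off `E(G)` play no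
role), and adjacent vertices receive different induced labels. -/
structure IsLocalAntimagicLabeling {V : Type*} [Fintype V] (G : SimpleGraph V)
    (f : Sym2 V → ℕ) : Prop where
  bijOn : Set.BijOn f G.edgeSet (Set.Icc 1 G.edgeSet.ncard)
  ne_of_adj : ∀ ⦃u v : V⦄, G.Adj u v → vertexLabel G f u ≠ vertexLabel G f v

/-- The number `c(f)` of distinct induced vertex labels. -/
noncomputable def numColors {V : Type*} [Fintype V] (G : SimpleGraph V) (f : Sym2 V → ℕ) : ℕ :=
  (Set.range (vertexLabel G f)).ncard

/-- The local antimagic chromatic number: the minimum of `c(f)` over all the local antimagic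
labelings `f` of `G` (it is `⊤` if there is none). -/
noncomputable def localAntimagicChromaticNumber {V : Type*} [Fintype V] (G : SimpleGraph V) :
    ℕ∞ :=
  ⨅ (f : Sym2 V → ℕ) (_ : IsLocalAntimagicLabeling G f), (numColors G f : ℕ∞)

/-- The triangular prism `C₃ × K₂` (cartesian product). -/
def prism : SimpleGraph (Fin 3 × Fin 2) :=
  (SimpleGraph.cycleGraph 3).boxProd (⊤ : SimpleGraph (Fin 2))

/-- The join `C_k ∨ O_l` of the cycle of order `k` and the null (edgeless) graph of order `l`. -/
def cycleJoinNull (k l : ℕ) : SimpleGraph (Fin k ⊕ Fin l) :=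
  join (SimpleGraph.cycleGraph k) (⊥ : SimpleGraph (Fin l))

end LocalAntimagic

/-!
Lower bound. The prism contains a triangle and so does `H = C_{2m} ∨ O_{2n}`; hence `G[H]` contains
`K₉`, on which `f⁺` is injective.

Upper bound. Write `N = 2m + 2n` and `q = 2m + 4mn` for the numbers of vertices and edges of `H`.
The edges of `G[H]` are those of six copies of `H`, and one complete bipartite `K_{N,N}` for each of
the nine edges of the prism. The labels `1, …, 6q` go to the copies and the rest to the blocks.

* Blocks. The nine blocks get consecutive intervals of `N²` labels, each arranged as a semi-magic
  square (`exists_semimagic_square`), so that the contribution of the blocks to `f⁺` depends only on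
  the copy. The intervals are ordered by a labeling of the prism whose vertex sums take three
  values and differ on adjacent vertices (`prismWeight`); as a result the contributions to adjacent
  copies differ by a nonzero multiple of `N³`.
* Copies. All six copies get the same three vertex sums, one on the even rim vertices, one on the odd
  rim vertices, one on the null vertices (`exists_copies_labeling`). After the change of variable
  `f = (λ + 6q + 1) / 2` the labels `λ` are the odd integers between `-6q` and `6q`. Those of large
  absolute value are used on the rim and on two null vertices, which form the graph `C_{2m} ∨ O_2`:
  signs and magnitudes there come from an `IsBalancedWheel`, whose signs cancel at every vertex, so
  that its magnitudes may be shifted, and multiplied by six and spread over the six copies. Those of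
  small absolute value form a signed rectangle (`exists_signed_rectangle`) with vanishing column
  sums, whose columns cancel in pairs; the pairs are shared out among the other null vertices of the
  six copies. The same rectangles give the semi-magic squares.

The three sums within a copy differ, by less than `2N³` after doubling (`abs_classSum_sub_lt`), so
adjacent vertices get different values of `f⁺`, and there are at most `3 · 3` values in all.
-/

namespace LocalAntimagic

open Finset

/-! ### Signs and signed rectangles -/

theorem sum_range_two_mul {M : Type*} [AddCommMonoid M] (g : ℕ → M) (n : ℕ) :
    ∑ j ∈ range (2 * n), g j = ∑ j ∈ range n, (g (2 * j) + g (2 * j + 1)) := by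
  induction n with
  | zero => simp
  | succ n ih =>
    rw [show 2 * (n + 1) = 2 * n + 1 + 1 by ring, sum_range_succ, sum_range_succ, ih,
      sum_range_succ, add_assoc]

theorem sum_neg_one_pow (n : ℕ) : ∑ j ∈ range (2 * n), (-1 : ℤ) ^ j = 0 := by
  rw [sum_range_two_mul]
  exact sum_eq_zero fun j _ => by rw [pow_succ]; ring

/-- The pattern `+ - - +` cancels on four consecutive odd numbers, which reduces the claim to `4` and
`6` summands, where `1 - 3 - 5 + 7 = 0` and `1 + 3 + 5 - 7 + 9 - 11 = 0`. -/
theorem exists_signs_sum_odd (r : ℕ) (hr : 2 ≤ r) :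
    ∃ σ : ℕ → ℤ, (∀ a, σ a = 1 ∨ σ a = -1) ∧ ∑ a ∈ range (2 * r), σ a * (2 * a + 1) = 0 := by
  induction r using Nat.strong_induction_on with
  | _ r ih =>
    rcases Nat.lt_or_ge r 4 with h | h
    · interval_cases r
      · exact ⟨fun a => if a = 1 ∨ a = 2 then -1 else 1, fun a => by dsimp only; split_ifs <;> simp,
          by simp [sum_range_succ]⟩
      · exact ⟨fun a => if a = 3 ∨ a = 5 then -1 else 1, fun a => by dsimp only; split_ifs <;> simp,
          by simp [sum_range_succ]⟩
    · obtain ⟨r, rfl⟩ : ∃ k, r = k + 2 := ⟨r - 2, by omega⟩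
      obtain ⟨σ, h1, h2⟩ := ih r (by omega) (by omega)
      refine ⟨fun a => if a < 2 * r then σ a else if a = 2 * r + 1 ∨ a = 2 * r + 2 then -1 else 1,
        fun a => ?_, ?_⟩
      · dsimp only
        split_ifs
        · exact h1 a
        · simp
        · simp
      · rw [show 2 * (r + 2) = 2 * r + 1 + 1 + 1 + 1 by ring]
        simp only [sum_range_succ]
        rw [sum_congr rfl (g := fun a : ℕ => σ a * (2 * a + 1))
          (fun a ha => by rw [if_pos (mem_range.1 ha)]), h2]
        simp
        ring

theorem sign_mul_inj {s s' M M' : ℤ} (hs : s = 1 ∨ s = -1) (hs' : s' = 1 ∨ s' = -1) (hM : 0 < M)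
    (hM' : 0 < M') (h : s * M = s' * M') : s = s' ∧ M = M' := by
  rcases hs with rfl | rfl <;> rcases hs' with rfl | rfl <;> omega

theorem abs_sign_mul {s M : ℤ} (hs : s = 1 ∨ s = -1) (hM : 0 < M) : |s * M| = M := by
  rcases hs with rfl | rfl <;> simp [abs_of_pos hM]

theorem odd_sign_mul {s M : ℤ} (hs : s = 1 ∨ s = -1) (hM : Odd M) : Odd (s * M) := by
  rcases hs with rfl | rfl <;> simpa using hM

theorem sign_mul_sign {s t : ℤ} (hs : s = 1 ∨ s = -1) (ht : t = 1 ∨ t = -1) :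
    s * t = 1 ∨ s * t = -1 := by
  rcases hs with rfl | rfl <;> rcases ht with rfl | rfl <;> simp

theorem neg_one_pow_inj {a b : ℕ} (h : (-1 : ℤ) ^ a = (-1) ^ b) : a % 2 = b % 2 := by
  rcases Nat.even_or_odd a with ha | ha <;> rcases Nat.even_or_odd b with hb | hb <;>
    rw [ha.neg_one_pow, hb.neg_one_pow] at h
  · rw [Nat.even_iff.1 ha, Nat.even_iff.1 hb]
  · norm_num at h
  · norm_num at h
  · rw [Nat.odd_iff.1 ha, Nat.odd_iff.1 hb]

/-- A `2r × 2L` array filled with the odd integers of absolute value less than `4rL`, with vanishing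
column sums, in which columns `2u` and `2u + 1` are opposite. With `σ` from `exists_signs_sum_odd`,
the entry in row `a` of column `2u` is `L σₐ (2a + 1) + (-1)ᵃ (2u + 1 - L)`: an `L`-fold dilation of
a single column, shifted by an alternating amount which identifies the column. -/
theorem exists_signed_rectangle (r L : ℕ) (hr : 2 ≤ r) :
    ∃ R : ℕ → ℕ → ℤ,
      (∀ a < 2 * r, ∀ J < 2 * L, Odd (R a J) ∧ |R a J| < 4 * r * L) ∧
      (∀ a < 2 * r, ∀ J < 2 * L, ∀ a' < 2 * r, ∀ J' < 2 * L, R a J = R a' J' → a = a' ∧ J = J') ∧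
      (∀ J, ∑ a ∈ range (2 * r), R a J = 0) ∧
      (∀ a u, R a (2 * u) + R a (2 * u + 1) = 0) := by
  obtain ⟨σ, hσ, hsum⟩ := exists_signs_sum_odd r hr
  have hpow : ∀ a : ℕ, (-1 : ℤ) ^ a = 1 ∨ (-1 : ℤ) ^ a = -1 := neg_one_pow_eq_or ℤ
  have hδ : ∀ a, σ a * (-1) ^ a = 1 ∨ σ a * (-1) ^ a = -1 := fun a =>
    sign_mul_sign (hσ a) (hpow a)
  have hε : ∀ a J, (-1) ^ J * σ a = 1 ∨ (-1) ^ J * σ a = -1 := fun a J =>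
    sign_mul_sign (hpow J) (hσ a)
  -- the absolute value of the entry in row `a`, columns `2u` and `2u + 1`
  obtain ⟨M, hM⟩ : ∃ M : ℕ → ℕ → ℤ, ∀ a u,
      M a u = L * (2 * a + 1) + σ a * (-1) ^ a * (2 * u + 1 - L) := ⟨_, fun _ _ => rfl⟩
  have key : ∀ a : ℕ, ∀ u < L, (2 * a * L : ℤ) < M a u ∧ M a u < (2 * a * L + 2 * L : ℤ) := by
    intro a u hu
    have hu' : (u : ℤ) < L := by exact_mod_cast hu
    rw [hM]
    rcases hδ a with h | h <;> rw [h] <;> constructor <;> linarith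
  have hpos : ∀ a : ℕ, ∀ u < L, 0 < M a u := fun a u hu =>
    lt_of_le_of_lt (by positivity) (key a u hu).1
  have form : ∀ a J, (-1 : ℤ) ^ J * σ a * M a (J / 2) =
      (-1 : ℤ) ^ J * (L * (σ a * (2 * a + 1)) + (-1) ^ a * (2 * (J / 2 : ℕ) + 1 - L)) := by
    intro a J
    rw [hM]
    rcases hσ a with h | h <;> rw [h] <;> ring
  refine ⟨fun a J => (-1) ^ J * σ a * M a (J / 2), ?_, ?_, ?_, ?_⟩
  · intro a ha J hJ
    have hs : (a : ℤ) + 1 ≤ 2 * r := by exact_mod_cast ha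
    have h1 := key a (J / 2) (by omega)
    refine ⟨odd_sign_mul (hε a J) ?_, ?_⟩
    · rw [hM]
      rcases hδ a with h | h <;> rw [h]
      · exact ⟨L * a + (J / 2 : ℕ), by ring⟩
      · exact ⟨L * a - (J / 2 : ℕ) - 1 + L, by ring⟩
    · dsimp only
      rw [abs_sign_mul (hε a J) (hpos a _ (by omega))]
      nlinarith [Int.natCast_nonneg L]
  · intro a ha J hJ a' ha' J' hJ' heq
    have k1 := key a (J / 2) (by omega)
    have k2 := key a' (J' / 2) (by omega)
    obtain ⟨hs, hMM⟩ := sign_mul_inj (hε a J) (hε a' J') (hpos a _ (by omega))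
      (hpos a' _ (by omega)) heq
    have hL : (0 : ℤ) ≤ L := by positivity
    have haa : a = a' := by
      rcases lt_trichotomy a a' with h | h | h
      · have : (a : ℤ) + 1 ≤ a' := by exact_mod_cast h
        nlinarith
      · exact h
      · have : (a' : ℤ) + 1 ≤ a := by exact_mod_cast h
        nlinarith
    subst haa
    have hσ0 : σ a ≠ 0 := by rcases hσ a with h | h <;> rw [h] <;> norm_num
    have hpar := neg_one_pow_inj (mul_right_cancel₀ hσ0 hs)
    rw [hM, hM] at hMM
    have hu : J / 2 = J' / 2 := by
      rcases hδ a with h | h <;> rw [h] at hMM <;> omega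
    exact ⟨rfl, by omega⟩
  · intro J
    simp only [form]
    rw [← mul_sum, sum_add_distrib, ← mul_sum, ← sum_mul, hsum, sum_neg_one_pow]
    ring
  · intro a u
    dsimp only
    rw [show 2 * u / 2 = u by omega, show (2 * u + 1) / 2 = u by omega, pow_succ]
    ring

/-! ### Balanced signed labelings of `C_{2m} ∨ O_2` -/

/-- A signed labeling of `C_{2m} ∨ O_2` in which each of `0, …, 3m - 1` is used once with each sign.
The edges are indexed by `i < 2m` and `c < 3`: for `c = 0` the rim edge joining the rim vertices `i`
and `i + 1`, for `c = 1, 2` the spoke from the rim vertex `i` to one of the two null vertices. The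
edge `(i, c)` has sign `s i c` and magnitude `k i c`. At every vertex the signs sum to `0`; the
signed magnitudes sum to `(-1) ^ i` at the rim vertex `i` and to `0` at the null vertices.
Indices of rim edges are read modulo `2m`, and `(i + (2m - 1)) % 2m` stands for `i - 1`. -/
structure IsBalancedWheel (m : ℕ) (s : ℕ → ℕ → ℤ) (k : ℕ → ℕ → ℕ) : Prop where
  sign : ∀ i c, s i c = 1 ∨ s i c = -1
  lt : ∀ i < 2 * m, ∀ c < 3, k i c < 3 * m
  inj : ∀ i < 2 * m, ∀ c < 3, ∀ i' < 2 * m, ∀ c' < 3, s i c = s i' c' → k i c = k i' c' →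
    i = i' ∧ c = c'
  rim_sign : ∀ i < 2 * m, s ((i + (2 * m - 1)) % (2 * m)) 0 + s i 0 + s i 1 + s i 2 = 0
  rim_sum : ∀ i < 2 * m, s ((i + (2 * m - 1)) % (2 * m)) 0 * k ((i + (2 * m - 1)) % (2 * m)) 0 +
    s i 0 * k i 0 + s i 1 * k i 1 + s i 2 * k i 2 = (-1) ^ i
  hub_sign : ∀ c, c = 1 ∨ c = 2 → ∑ i ∈ range (2 * m), s i c = 0
  hub_sum : ∀ c, c = 1 ∨ c = 2 → ∑ i ∈ range (2 * m), s i c * k i c = 0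

/-- The general pattern of signs fails for `m = 2`, which is handled by an explicit labeling. -/
theorem isBalancedWheel_two : IsBalancedWheel 2
    (fun i c => if (i = 0 ∧ c = 2) ∨ (i = 1 ∧ 1 ≤ c) ∨ (i = 2 ∧ c ≤ 1) ∨ (i = 3 ∧ c = 0)
      then 1 else -1)
    (fun i c => ([[0, 1, 2], [5, 1, 3], [5, 4, 3], [0, 4, 2]].getD i []).getD c 0) where
  sign i c := by split_ifs <;> simp
  lt := by decide
  inj i hi c hc i' hi' c' hc' := by
    have key : ∀ i i' : Fin 4, ∀ c c' : Fin 3,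
        ((if (i.1 = 0 ∧ c.1 = 2) ∨ (i.1 = 1 ∧ 1 ≤ c.1) ∨ (i.1 = 2 ∧ c.1 ≤ 1) ∨ (i.1 = 3 ∧ c.1 = 0)
          then 1 else -1 : ℤ) =
        if (i'.1 = 0 ∧ c'.1 = 2) ∨ (i'.1 = 1 ∧ 1 ≤ c'.1) ∨ (i'.1 = 2 ∧ c'.1 ≤ 1) ∨
          (i'.1 = 3 ∧ c'.1 = 0) then 1 else -1) →
        ([[0, 1, 2], [5, 1, 3], [5, 4, 3], [0, 4, 2]].getD i.1 []).getD c.1 0 =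
          ([[0, 1, 2], [5, 1, 3], [5, 4, 3], [0, 4, 2]].getD i'.1 []).getD c'.1 0 →
        i.1 = i'.1 ∧ c.1 = c'.1 := by decide
    exact key ⟨i, hi⟩ ⟨i', hi'⟩ ⟨c, hc⟩ ⟨c', hc'⟩
  rim_sign := by decide
  rim_sum := by decide
  hub_sign := by rintro c (rfl | rfl) <;> decide
  hub_sum := by rintro c (rfl | rfl) <;> decide

/-- The magnitude of the positive spoke at the rim vertex `i`. With `p = m + (m - 1) / 2` the odd rim
vertices `1, 3, …, 2m - 1` get `p, …, p + m - 1` and the vertex `0` gets `p + m`. The even ones get the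
remaining numbers in `[m, 3m)`, first those below `p`, then those above `p + m`. -/
def spokePos (m i : ℕ) : ℕ :=
  if i % 2 = 1 then m + (m - 1) / 2 + i / 2
  else if i = 0 then m + (m - 1) / 2 + m
  else if i / 2 ≤ (m - 1) / 2 then m + i / 2 - 1 else 2 * m + i / 2

/-- The magnitude of the negative spoke at the rim vertex `i`: shifted by one from `spokePos` at the
odd vertices, so that the missing value `p` is left for the vertex `0`; equal to `spokePos` at the
other even vertices. -/
def spokeNeg (m i : ℕ) : ℕ :=
  if i % 2 = 1 then m + (m - 1) / 2 + i / 2 + 1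
  else if i = 0 then m + (m - 1) / 2
  else if i / 2 ≤ (m - 1) / 2 then m + i / 2 - 1 else 2 * m + i / 2

theorem spokePos_inj {m i i' : ℕ} (hm : 1 ≤ m) (hi : i < 2 * m) (hi' : i' < 2 * m)
    (h : spokePos m i = spokePos m i') : i = i' := by
  unfold spokePos at h
  split_ifs at h <;> omega

theorem spokeNeg_inj {m i i' : ℕ} (hm : 1 ≤ m) (hi : i < 2 * m) (hi' : i' < 2 * m)
    (h : spokeNeg m i = spokeNeg m i') : i = i' := by
  unfold spokeNeg at h
  split_ifs at h <;> omega

theorem spokePos_mem {m i : ℕ} (hi : i < 2 * m) : m ≤ spokePos m i ∧ spokePos m i < 3 * m := by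
  unfold spokePos
  split_ifs <;> omega

theorem spokeNeg_mem {m i : ℕ} (hi : i < 2 * m) : m ≤ spokeNeg m i ∧ spokeNeg m i < 3 * m := by
  unfold spokeNeg
  split_ifs <;> omega

theorem spokePos_sub_spokeNeg (m i : ℕ) : (spokePos m i : ℤ) - spokeNeg m i =
    if i % 2 = 1 then -1 else if i = 0 then (m : ℤ) else 0 := by
  unfold spokePos spokeNeg
  split_ifs <;> push_cast <;> ring

theorem sum_spokePos_sub_spokeNeg {m : ℕ} (hm : 1 ≤ m) :
    ∑ i ∈ range (2 * m), ((spokePos m i : ℤ) - spokeNeg m i) = 0 := by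
  obtain ⟨n, rfl⟩ : ∃ n, m = n + 1 := ⟨m - 1, by omega⟩
  rw [sum_range_two_mul]
  have : ∀ j, ((spokePos (n + 1) (2 * j) : ℤ) - spokeNeg (n + 1) (2 * j) +
      (spokePos (n + 1) (2 * j + 1) - spokeNeg (n + 1) (2 * j + 1))) =
      (if j = 0 then (n + 1 : ℤ) else 0) - 1 := by
    intro j
    rw [spokePos_sub_spokeNeg, spokePos_sub_spokeNeg]
    split_ifs <;> omega
  simp only [this, sum_sub_distrib]
  simp

/-- The rim edges `2j` and `2j + 1` have labels `j` and `-j`. The sums at the rim vertices are then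
right whichever of the two null vertices the positive spoke goes to; the signs `τ` make this choice,
and the two hypotheses say that the null vertices come out balanced. -/
theorem isBalancedWheel_of_signs {m : ℕ} (hm : 2 ≤ m) {τ : ℕ → ℤ} (hτ : ∀ i, τ i = 1 ∨ τ i = -1)
    (h0 : ∑ i ∈ range (2 * m), τ i = 0)
    (h1 : ∑ i ∈ range (2 * m), τ i * (spokePos m i + spokeNeg m i) = 0) :
    IsBalancedWheel m
      (fun i c => if c = 0 then (-1) ^ i else if c = 1 then τ i else -τ i)
      (fun i c => if c = 0 then i / 2
        else if (if c = 1 then τ i else -τ i) = 1 then spokePos m i else spokeNeg m i) where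
  sign i c := by
    split_ifs
    · exact neg_one_pow_eq_or ℤ i
    · exact hτ i
    · rcases hτ i with h | h <;> simp [h]
  lt i hi c hc := by
    have := (spokePos_mem hi).2
    have := (spokeNeg_mem hi).2
    split_ifs <;> omega
  inj i hi c hc i' hi' c' hc' hs hk := by
    have a1 := spokePos_mem hi
    have a2 := spokePos_mem hi'
    have a3 := spokeNeg_mem hi
    have a4 := spokeNeg_mem hi'
    have a5 := fun h => spokePos_inj (by omega) hi hi' h
    have a6 := fun h => spokeNeg_inj (by omega) hi hi' h
    by_cases hc0 : c = 0 <;> by_cases hc0' : c' = 0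
    · simp only [hc0, hc0', if_true] at hs hk
      have := neg_one_pow_inj hs
      omega
    · simp only [hc0, hc0', if_true, if_false] at hk
      split_ifs at hk <;> omega
    · simp only [hc0, hc0', if_true, if_false] at hk
      split_ifs at hk <;> omega
    · simp only [hc0, hc0', if_false] at hs hk
      rw [hs] at hk
      obtain rfl : i = i' := by
        split_ifs at hk
        all_goals first | exact a5 hk | exact a6 hk
      rcases hτ i with h | h <;> rw [h] at hs <;> split_ifs at hs <;> omega
  rim_sign i hi := by
    have hp : (-1 : ℤ) ^ ((i + (2 * m - 1)) % (2 * m)) = -(-1) ^ i := by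
      rcases Nat.eq_zero_or_pos i with rfl | h
      · rw [Nat.zero_add, Nat.mod_eq_of_lt (by omega), Odd.neg_one_pow ⟨m - 1, by omega⟩]
        simp
      · rw [show i + (2 * m - 1) = (i - 1) + 2 * m by omega, Nat.add_mod_right,
          Nat.mod_eq_of_lt (by omega)]
        obtain ⟨j, rfl⟩ : ∃ j, i = j + 1 := ⟨i - 1, by omega⟩
        rw [Nat.add_sub_cancel, pow_succ]
        ring
    simp [hp]
  rim_sum i hi := by
    have hw : τ i * (if τ i = 1 then spokePos m i else spokeNeg m i : ℕ) +
        -τ i * (if -τ i = 1 then spokePos m i else spokeNeg m i : ℕ) =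
        (spokePos m i : ℤ) - spokeNeg m i := by
      rcases hτ i with h | h <;> simp [h] <;> ring
    have hc : (-1 : ℤ) ^ ((i + (2 * m - 1)) % (2 * m)) * ((i + (2 * m - 1)) % (2 * m) / 2 : ℕ) +
        (-1) ^ i * (i / 2 : ℕ) = if i % 2 = 1 then 0 else if i = 0 then 1 - (m : ℤ) else 1 := by
      rcases Nat.eq_zero_or_pos i with rfl | h
      · rw [Nat.zero_add, Nat.mod_eq_of_lt (by omega), Odd.neg_one_pow ⟨m - 1, by omega⟩,
          show (2 * m - 1) / 2 = m - 1 by omega]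
        push_cast [show 1 ≤ m by omega]
        simp
      · rw [show i + (2 * m - 1) = (i - 1) + 2 * m by omega, Nat.add_mod_right,
          Nat.mod_eq_of_lt (by omega)]
        rcases Nat.even_or_odd' i with ⟨j, rfl | rfl⟩
        · rw [Odd.neg_one_pow (n := 2 * j - 1) ⟨j - 1, by omega⟩,
            Even.neg_one_pow (n := 2 * j) ⟨j, by ring⟩,
            show (2 * j - 1) / 2 = j - 1 by omega, show 2 * j / 2 = j by omega,
            if_neg (by omega), if_neg (by omega)]
          push_cast [show 1 ≤ j by omega]
          ring
        · rw [Odd.neg_one_pow (n := 2 * j + 1) ⟨j, by omega⟩,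
            Even.neg_one_pow (n := 2 * j + 1 - 1) ⟨j, by omega⟩,
            show (2 * j + 1 - 1) / 2 = j by omega, show (2 * j + 1) / 2 = j by omega,
            if_pos (by omega)]
          ring
    have hd := spokePos_sub_spokeNeg m i
    have hpar : (-1 : ℤ) ^ i = if i % 2 = 1 then -1 else 1 := by
      split_ifs with h
      · exact Odd.neg_one_pow (Nat.odd_iff.2 h)
      · exact Even.neg_one_pow (Nat.even_iff.2 (by omega))
    simp only [if_true, one_ne_zero, if_false, OfNat.ofNat_ne_zero, OfNat.ofNat_ne_one] at hw ⊢
    rw [add_assoc, hc, hw, hd, hpar]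
    split_ifs <;> ring
  hub_sign c hc := by
    rcases hc with rfl | rfl
    · simpa using h0
    · simpa using h0
  hub_sum c hc := by
    have h2 := sum_spokePos_sub_spokeNeg (m := m) (by omega)
    have e1 : ∀ i, 2 * (τ i * (if τ i = 1 then spokePos m i else spokeNeg m i : ℕ)) =
        ((spokePos m i : ℤ) - spokeNeg m i) + τ i * (spokePos m i + spokeNeg m i) := by
      intro i
      rcases hτ i with h | h <;> simp [h] <;> ring
    have e2 : ∀ i, 2 * (-τ i * (if -τ i = 1 then spokePos m i else spokeNeg m i : ℕ))
        = ((spokePos m i : ℤ) - spokeNeg m i) - τ i * (spokePos m i + spokeNeg m i) := by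
      intro i
      rcases hτ i with h | h <;> simp [h] <;> ring
    have two : (2 : ℤ) ≠ 0 := by norm_num
    rcases hc with rfl | rfl
    · simp only [if_true, one_ne_zero, if_false]
      apply mul_left_cancel₀ two
      rw [mul_sum, sum_congr rfl (fun i _ => e1 i), sum_add_distrib, h1, h2]
      rfl
    · simp only [if_false, OfNat.ofNat_ne_zero, OfNat.ofNat_ne_one]
      apply mul_left_cancel₀ two
      rw [mul_sum, sum_congr rfl (fun i _ => e2 i), sum_sub_distrib, h1, h2]
      rfl

theorem sum_range_add_two_mul (c : ℤ) (n : ℕ) :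
    ∑ j ∈ range n, (c + 2 * j) = n * (c + n - 1) := by
  induction n with
  | zero => simp
  | succ n ih => rw [sum_range_succ, ih]; push_cast; ring

theorem sum_spokes_odd_index (m : ℕ) : ∑ j ∈ range m, ((spokePos m (2 * j + 1) : ℤ) +
    spokeNeg m (2 * j + 1)) = 3 * m * m + 2 * m * ((m - 1) / 2 : ℕ) := by
  have : ∀ j, ((spokePos m (2 * j + 1) : ℤ) + spokeNeg m (2 * j + 1)) =
      (2 * (m + ((m - 1) / 2 : ℕ)) + 1) + 2 * j := by
    intro j
    unfold spokePos spokeNeg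
    rw [if_pos (by omega), if_pos (by omega), show (2 * j + 1) / 2 = j by omega]
    push_cast
    ring
  simp only [this, sum_range_add_two_mul]
  ring

theorem spoke_low (m j : ℕ) (hj : j < (m - 1) / 2) :
    (spokePos m (2 * (j + 1)) : ℤ) + spokeNeg m (2 * (j + 1)) = 2 * m + 2 * j := by
  have c1 : ¬2 * (j + 1) % 2 = 1 := by omega
  have c2 : ¬2 * (j + 1) = 0 := by omega
  have c3 : j + 1 ≤ (m - 1) / 2 := by omega
  have e : 2 * (j + 1) / 2 = j + 1 := by omega
  rw [spokePos, spokeNeg, if_neg c1, if_neg c1, if_neg c2, if_neg c2, e, if_pos c3]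
  omega

theorem spoke_high (m j : ℕ) (hj : (m - 1) / 2 ≤ j) :
    (spokePos m (2 * (j + 1)) : ℤ) + spokeNeg m (2 * (j + 1)) = 4 * m + 2 + 2 * j := by
  have c1 : ¬2 * (j + 1) % 2 = 1 := by omega
  have c2 : ¬2 * (j + 1) = 0 := by omega
  have c3 : ¬j + 1 ≤ (m - 1) / 2 := by omega
  have e : 2 * (j + 1) / 2 = j + 1 := by omega
  rw [spokePos, spokeNeg, if_neg c1, if_neg c1, if_neg c2, if_neg c2, e, if_neg c3]
  omega

theorem spoke_zero (m : ℕ) :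
    (spokePos m (2 * 0) : ℤ) + spokeNeg m (2 * 0) = 3 * m + 2 * ((m - 1) / 2 : ℕ) := by
  simp [spokePos, spokeNeg]
  ring

theorem sum_spokes_even_index {h : ℕ} (m : ℕ) (hh : (m - 1) / 2 = h) :
    ∑ j ∈ range (2 * h), ((spokePos m (2 * (j + 1)) : ℤ) + spokeNeg m (2 * (j + 1))) =
      6 * m * h + 4 * h * h := by
  have e1 : ∀ j ∈ range h, ((spokePos m (2 * (j + 1)) : ℤ) + spokeNeg m (2 * (j + 1))) =
      2 * m + 2 * j := fun j hj => spoke_low m j (by rw [hh]; exact mem_range.1 hj)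
  have e2 : ∀ j ∈ range h, ((spokePos m (2 * (h + j + 1)) : ℤ) + spokeNeg m (2 * (h + j + 1))) =
      (4 * m + 2 + 2 * h) + 2 * j := fun j _ => by
    rw [spoke_high m (h + j) (by omega)]; push_cast; ring
  rw [two_mul h, sum_range_add, sum_congr rfl e1, sum_congr rfl e2, sum_range_add_two_mul,
    sum_range_add_two_mul]
  ring

/-- For odd `m = 2h + 1` the sums `spokePos + spokeNeg` are symmetric about their value at `0`, which
is also their value at `2h + 1`: positive signs at the odd vertices and negative ones at the even
vertices, exchanged at the vertices `0` and `2h + 1`, cancel. -/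
theorem exists_spoke_signs_odd {h : ℕ} : ∃ τ : ℕ → ℤ, (∀ i, τ i = 1 ∨ τ i = -1) ∧
    ∑ i ∈ range (2 * (2 * h + 1)), τ i = 0 ∧
    ∑ i ∈ range (2 * (2 * h + 1)), τ i *
      (spokePos (2 * h + 1) i + spokeNeg (2 * h + 1) i) = 0 := by
  obtain ⟨τ, hτ⟩ : ∃ τ : ℕ → ℤ, ∀ i, τ i = if i = 0 then 1 else if i % 2 = 0 then -1 else
    if i = 2 * h + 1 then -1 else 1 := ⟨_, fun _ => rfl⟩
  have t0 : τ (2 * 0) = 1 := by simp [hτ]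
  have te : ∀ j, τ (2 * (j + 1)) = -1 := fun j => by
    rw [hτ, if_neg (by omega), if_pos (by omega)]
  have tt : ∀ j, τ (2 * j + 1) = 1 - if j = h then 2 else 0 := fun j => by
    rw [hτ, if_neg (by omega), if_neg (by omega)]
    split_ifs <;> omega
  refine ⟨τ, fun i => by rw [hτ]; split_ifs <;> simp, ?_, ?_⟩
  · rw [sum_range_two_mul, sum_add_distrib, sum_range_succ']
    simp only [t0, te, tt, sum_sub_distrib, sum_ite_eq', mem_range]
    rw [if_pos (by omega)]
    simp
    ring
  · rw [sum_range_two_mul, sum_add_distrib, sum_range_succ']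
    have hd : (2 * h + 1 - 1) / 2 = h := by omega
    have e : (spokePos (2 * h + 1) (2 * h + 1) : ℤ) + spokeNeg (2 * h + 1) (2 * h + 1) =
        8 * h + 3 := by
      unfold spokePos spokeNeg
      rw [if_pos (by omega), if_pos (by omega)]
      omega
    simp only [t0, te, tt, sub_mul, sum_sub_distrib, ite_mul, one_mul, zero_mul, sum_ite_eq',
      mem_range, neg_mul, sum_neg_distrib, sum_spokes_odd_index, spoke_zero,
      sum_spokes_even_index (2 * h + 1) hd]
    rw [if_pos (by omega), e, hd]
    push_cast
    ring

/-- For even `m = 2h + 2` the spokes at the vertex `2(2h + 1)` exceed the symmetric pattern. Their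
sign, too, is reversed, together with those at the odd vertices `2h + 3` and `4h + 3`. -/
theorem exists_spoke_signs_even {h : ℕ} (hh : 1 ≤ h) : ∃ τ : ℕ → ℤ, (∀ i, τ i = 1 ∨ τ i = -1) ∧
    ∑ i ∈ range (2 * (2 * h + 2)), τ i = 0 ∧
    ∑ i ∈ range (2 * (2 * h + 2)), τ i *
      (spokePos (2 * h + 2) i + spokeNeg (2 * h + 2) i) = 0 := by
  obtain ⟨τ, hτ⟩ : ∃ τ : ℕ → ℤ, ∀ i, τ i = if i = 0 ∨ i = 2 * (2 * h + 1) then 1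
    else if i % 2 = 0 then -1 else
    if i = 2 * (h + 1) + 1 ∨ i = 2 * (2 * h + 1) + 1 then -1 else 1 := ⟨_, fun _ => rfl⟩
  have t0 : τ (2 * 0) = 1 := by simp [hτ]
  have te : ∀ j, τ (2 * (j + 1)) = (if j = 2 * h then 2 else 0) - 1 := fun j => by
    rw [hτ]
    by_cases hj : j = 2 * h
    · rw [if_pos (by omega), if_pos hj]; rfl
    · rw [if_neg (by omega), if_pos (by omega), if_neg hj]; rfl
  have tt : ∀ j, τ (2 * j + 1) = 1 - (if j = h + 1 then 2 else 0) -
      (if j = 2 * h + 1 then 2 else 0) := fun j => by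
    rw [hτ, if_neg (by omega), if_neg (by omega)]
    by_cases hj : j = h + 1
    · rw [if_pos (by omega), if_pos hj, if_neg (by omega)]; rfl
    · by_cases hj' : j = 2 * h + 1
      · rw [if_pos (by omega), if_neg hj, if_pos hj']; rfl
      · rw [if_neg (by omega), if_neg hj, if_neg hj']; rfl
  refine ⟨τ, fun i => by rw [hτ]; split_ifs <;> simp, ?_, ?_⟩
  · rw [sum_range_two_mul, sum_add_distrib, sum_range_succ']
    simp only [t0, te, tt, sum_sub_distrib, sum_ite_eq', mem_range]
    rw [if_pos (by omega), if_pos (by omega), if_pos (by omega)]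
    simp
    ring
  · rw [sum_range_two_mul, sum_add_distrib, sum_range_succ']
    have hd : (2 * h + 2 - 1) / 2 = h := by omega
    have e : ∀ j, (spokePos (2 * h + 2) (2 * j + 1) : ℤ) + spokeNeg (2 * h + 2) (2 * j + 1) =
        6 * h + 5 + 2 * j := by
      intro j
      unfold spokePos spokeNeg
      rw [if_pos (by omega), if_pos (by omega)]
      omega
    simp only [t0, te, tt, sub_mul, sum_sub_distrib, ite_mul, one_mul, zero_mul, sum_ite_eq',
      mem_range, sum_spokes_odd_index, spoke_zero]
    rw [if_pos (by omega), if_pos (by omega), if_pos (by omega), e, e, sum_range_succ,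
      sum_spokes_even_index (2 * h + 2) hd, spoke_high _ _ (by omega), hd]
    push_cast
    ring

theorem exists_isBalancedWheel {m : ℕ} (hm : 2 ≤ m) : ∃ s k, IsBalancedWheel m s k := by
  rcases Nat.even_or_odd' m with ⟨h, rfl | rfl⟩
  · rcases Nat.lt_or_ge h 2 with h2 | h2
    · obtain rfl : h = 1 := by omega
      exact ⟨_, _, isBalancedWheel_two⟩
    · obtain ⟨h, rfl⟩ : ∃ k, h = k + 1 := ⟨h - 1, by omega⟩
      obtain ⟨τ, h1, h2, h3⟩ := exists_spoke_signs_even (h := h) (by omega)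
      exact ⟨_, _, isBalancedWheel_of_signs hm h1 h2 h3⟩
  · obtain ⟨τ, h1, h2, h3⟩ := exists_spoke_signs_odd (h := h)
    exact ⟨_, _, isBalancedWheel_of_signs hm h1 h2 h3⟩

/-! ### Labeling six copies of `C_{2m} ∨ O_{2n}` -/

/-- A labeling of six disjoint copies of `C_{2m} ∨ O_{2n}` by the odd integers of absolute value less
than `12m(2n + 1)`, with the same vertex sums in all the copies. Here `t` is the copy, and the edges
are indexed as in `IsBalancedWheel`: `(i, 0)` is a rim edge and `(i, j + 1)` the spoke from the rim
vertex `i` to the null vertex `j`. -/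
theorem exists_copies_labeling {m n : ℕ} (hm : 2 ≤ m) (hn : 1 ≤ n) : ∃ lab : ℕ → ℕ → ℕ → ℤ,
    (∀ t < 6, ∀ i < 2 * m, ∀ c < 2 * n + 1,
      Odd (lab t i c) ∧ |lab t i c| < 12 * m * (2 * n + 1)) ∧
    (∀ t < 6, ∀ i < 2 * m, ∀ c < 2 * n + 1, ∀ t' < 6, ∀ i' < 2 * m, ∀ c' < 2 * n + 1,
      lab t i c = lab t' i' c' → t = t' ∧ i = i' ∧ c = c') ∧
    (∀ t, ∀ i < 2 * m, lab t ((i + (2 * m - 1)) % (2 * m)) 0 +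
      ∑ c ∈ range (2 * n + 1), lab t i c = 12 * (-1) ^ i) ∧
    (∀ t, ∀ c, c ≠ 0 → ∑ i ∈ range (2 * m), lab t i c = 0) := by
  obtain ⟨l, rfl⟩ : ∃ l, n = l + 1 := ⟨n - 1, by omega⟩
  obtain ⟨s, k, hw⟩ := exists_isBalancedWheel hm
  -- The rectangle takes up the odd numbers of absolute value below `24ml`.
  obtain ⟨R, hR, Rinj, Rcol, Rrow⟩ := exists_signed_rectangle m (6 * l) hm
  -- The absolute value of a wheel edge in copy `t`. It is `6(2k + 1) + 2t - 5` up to the shift by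
  -- `24ml`; both the shift and the term in `t` are invisible to the sums, as the signs cancel.
  obtain ⟨M, hM⟩ : ∃ M : ℕ → ℕ → ℕ → ℤ, ∀ t i c,
      M t i c = 24 * m * l + 2 * (6 * k i c + t) + 1 := ⟨_, fun _ _ _ => rfl⟩
  have hMpos : ∀ t i c, (24 * m * l : ℤ) < M t i c := fun t i c => by rw [hM]; linarith
  have hMpos' : ∀ t i c, 0 < M t i c := fun t i c => lt_of_le_of_lt (by positivity) (hMpos t i c)
  obtain ⟨lab, hlab⟩ : ∃ lab : ℕ → ℕ → ℕ → ℤ, ∀ t i c, lab t i c =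
    if c < 3 then s i c * M t i c else R i (2 * (6 * ((c - 3) / 2) + t) + (c - 3) % 2) :=
    ⟨_, fun _ _ _ => rfl⟩
  have small : ∀ t i c, c < 3 → lab t i c = s i c * M t i c := fun t i c h => by
    rw [hlab, if_pos h]
  have large : ∀ t i c, ¬c < 3 →
      lab t i c = R i (2 * (6 * ((c - 3) / 2) + t) + (c - 3) % 2) := fun t i c h => by
    rw [hlab, if_neg h]
  have hJ : ∀ t < 6, ∀ c < 2 * (l + 1) + 1, ¬c < 3 →
      2 * (6 * ((c - 3) / 2) + t) + (c - 3) % 2 < 2 * (6 * l) := by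
    intro t ht c hc h
    omega
  have hRlt : ∀ t < 6, ∀ i < 2 * m, ∀ c < 2 * (l + 1) + 1, ¬c < 3 →
      |lab t i c| < 24 * m * l := by
    intro t ht i hi c hc h
    rw [large t i c h]
    have := (hR i hi _ (hJ t ht c hc h)).2
    push_cast at this
    linarith
  have hsmall : ∀ t i c, c < 3 → (24 * m * l : ℤ) < |lab t i c| := by
    intro t i c h
    rw [small t i c h, abs_sign_mul (hw.sign i c) (hMpos' t i c)]
    exact hMpos t i c
  refine ⟨lab, ?_, ?_, ?_, ?_⟩
  · intro t ht i hi c hc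
    by_cases h : c < 3
    · rw [small t i c h, abs_sign_mul (hw.sign i c) (hMpos' t i c)]
      refine ⟨odd_sign_mul (hw.sign i c) ?_, ?_⟩
      · rw [hM]
        exact ⟨12 * m * l + (6 * k i c + t), by ring⟩
      · rw [hM]
        have h1 : (k i c : ℤ) + 1 ≤ 3 * m := by exact_mod_cast hw.lt i hi c h
        have h2 : (t : ℤ) + 1 ≤ 6 := by exact_mod_cast ht
        push_cast
        nlinarith
    · refine ⟨?_, ?_⟩
      · rw [large t i c h]
        exact (hR i hi _ (hJ t ht c hc h)).1
      · refine (hRlt t ht i hi c hc h).trans_le ?_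
        push_cast
        nlinarith
  · intro t ht i hi c hc t' ht' i' hi' c' hc' h
    by_cases h3 : c < 3 <;> by_cases h3' : c' < 3
    · rw [small t i c h3, small t' i' c' h3'] at h
      obtain ⟨h1, h2⟩ := sign_mul_inj (hw.sign i c) (hw.sign i' c') (hMpos' t i c)
        (hMpos' t' i' c') h
      rw [hM, hM] at h2
      have hk : k i c = k i' c' := by omega
      obtain ⟨hi, hc⟩ := hw.inj i hi c h3 i' hi' c' h3' h1 hk
      exact ⟨by omega, hi, hc⟩
    · have h1 := hsmall t i c h3
      have h2 := hRlt t' ht' i' hi' c' hc' h3'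
      rw [h] at h1
      linarith
    · have h1 := hsmall t' i' c' h3'
      have h2 := hRlt t ht i hi c hc h3
      rw [h] at h2
      linarith
    · rw [large t i c h3, large t' i' c' h3'] at h
      obtain ⟨h1, h2⟩ := Rinj i hi _ (hJ t ht c hc h3) i' hi' _ (hJ t' ht' c' hc' h3') h
      exact ⟨by omega, h1, by omega⟩
  · intro t i hi
    have hodd : ∀ g : ℕ → ℤ, ∑ c ∈ range (2 * (l + 1) + 1), g c =
        g 0 + g 1 + g 2 + ∑ u ∈ range l, (g (2 * u + 3) + g (2 * u + 1 + 3)) := by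
      intro g
      rw [show 2 * (l + 1) + 1 = 3 + 2 * l by ring, sum_range_add, sum_range_two_mul]
      simp only [sum_range_succ, sum_range_zero, zero_add, add_comm 3]
    have hz : ∀ u ∈ range l, lab t i (2 * u + 3) + lab t i (2 * u + 1 + 3) = 0 := by
      intro u _
      rw [large _ _ _ (by omega), large _ _ _ (by omega), Nat.add_sub_cancel, Nat.add_sub_cancel,
        show (2 * u) / 2 = u by omega, show (2 * u) % 2 = 0 by omega,
        show (2 * u + 1) / 2 = u by omega, show (2 * u + 1) % 2 = 1 by omega]
      exact Rrow i _
    rw [hodd, sum_eq_zero hz, small _ _ 0 (by omega), small _ _ 0 (by omega),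
      small _ _ 1 (by omega), small _ _ 2 (by omega), hM, hM, hM, hM]
    have h1 := hw.rim_sign i hi
    have h2 := hw.rim_sum i hi
    linear_combination (24 * m * l + 2 * t + 1 : ℤ) * h1 + 12 * h2
  · intro t c hc
    by_cases h : c < 3
    · have e : ∀ i, lab t i c = (24 * m * l + 2 * t + 1 : ℤ) * s i c + 12 * (s i c * k i c) := by
        intro i
        rw [small t i c h, hM]
        ring
      simp only [e, sum_add_distrib, ← mul_sum]
      rw [hw.hub_sign c (by omega), hw.hub_sum c (by omega)]
      ring
    · simp only [large t _ c h]
      exact Rcol _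

/-- The labeling of `exists_copies_labeling` transported by `λ ↦ (λ + 6q + 1) / 2`, where
`6q = 12m(2n + 1)` is the number of edges of the six copies. A rim vertex has degree `2n + 2` and a
null vertex degree `2m`, whence the right-hand sides. -/
theorem exists_copies_natLabeling {m n : ℕ} (hm : 2 ≤ m) (hn : 1 ≤ n) :
    ∃ g : ℕ → ℕ → ℕ → ℕ,
    (∀ t < 6, ∀ i < 2 * m, ∀ c < 2 * n + 1, 1 ≤ g t i c ∧ g t i c ≤ 12 * m * (2 * n + 1)) ∧
    (∀ t < 6, ∀ i < 2 * m, ∀ c < 2 * n + 1, ∀ t' < 6, ∀ i' < 2 * m, ∀ c' < 2 * n + 1,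
      g t i c = g t' i' c' → t = t' ∧ i = i' ∧ c = c') ∧
    (∀ t < 6, ∀ i < 2 * m, 2 * ((g t ((i + (2 * m - 1)) % (2 * m)) 0 +
      ∑ c ∈ range (2 * n + 1), g t i c : ℕ) : ℤ) =
        12 * (-1) ^ i + (2 * n + 2) * (12 * m * (2 * n + 1) + 1)) ∧
    (∀ t < 6, ∀ c < 2 * n + 1, c ≠ 0 → 2 * ((∑ i ∈ range (2 * m), g t i c : ℕ) : ℤ) =
      2 * m * (12 * m * (2 * n + 1) + 1)) := by
  obtain ⟨lab, h1, h2, h3, h4⟩ := exists_copies_labeling hm hn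
  have key : ∀ t < 6, ∀ i < 2 * m, ∀ c < 2 * n + 1, ∃ x : ℕ,
      (1 ≤ x ∧ x ≤ 12 * m * (2 * n + 1)) ∧
      2 * (x : ℤ) = lab t i c + (12 * m * (2 * n + 1) + 1) := by
    intro t ht i hi c hc
    obtain ⟨⟨y, hy⟩, hlt⟩ := h1 t ht i hi c hc
    rw [abs_lt] at hlt
    have e : (12 * m * (2 * n + 1) : ℤ) = 2 * (6 * m * (2 * n + 1)) := by ring
    generalize hq : (6 * m * (2 * n + 1) : ℤ) = q at e
    have e' : ((12 * m * (2 * n + 1) : ℕ) : ℤ) = 2 * q := by push_cast; exact e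
    refine ⟨(y + q + 1).toNat, ⟨?_, ?_⟩, ?_⟩
    · omega
    · zify
      rw [Int.toNat_of_nonneg (by omega)]
      push_cast at e'
      omega
    · rw [Int.toNat_of_nonneg (by omega), e, hy]
      ring
  choose! g g1 g2 using key
  refine ⟨g, g1, ?_, ?_, ?_⟩
  · intro t ht i hi c hc t' ht' i' hi' c' hc' h
    have e1 := g2 t ht i hi c hc
    have e2 := g2 t' ht' i' hi' c' hc'
    rw [h] at e1
    exact h2 t ht i hi c hc t' ht' i' hi' c' hc' (by linarith)
  · intro t ht i hi
    have e1 := g2 t ht _ (Nat.mod_lt (i + (2 * m - 1)) (show 0 < 2 * m by omega)) 0 (by omega)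
    rw [Nat.cast_add, mul_add, e1, Nat.cast_sum, mul_sum,
      sum_congr rfl (fun c hc => g2 t ht i hi c (mem_range.1 hc)), sum_add_distrib, ← h3 t i hi,
      sum_const, card_range, nsmul_eq_mul]
    push_cast
    ring
  · intro t ht c hc hc0
    rw [Nat.cast_sum, mul_sum, sum_congr rfl (fun i hi => g2 t ht i (mem_range.1 hi) c hc),
      sum_add_distrib, h4 t c hc0, sum_const, card_range, nsmul_eq_mul]
    push_cast
    ring

/-! ### Semi-magic squares -/

/-- Semi-magic squares exist in every even order `2r ≥ 4`; the entries are `0, …, (2r)² - 1`. -/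
theorem exists_semimagic_square (W : Type*) [Fintype W] (r : ℕ) (hr : 2 ≤ r)
    (hW : Fintype.card W = 2 * r) : ∃ (S : W → W → ℕ) (K : ℕ),
    (∀ u v, S u v < Fintype.card W ^ 2) ∧
    (∀ u v u' v', S u v = S u' v' → u = u' ∧ v = v') ∧
    (∀ v, ∑ u, S u v = K) ∧ (∀ u, ∑ v, S u v = K) := by
  obtain ⟨R, hR, Rinj, Rcol, Rrow⟩ := exists_signed_rectangle r r hr
  have φ : W ≃ Fin (2 * r) := Fintype.equivFinOfCardEq hW
  have key : ∀ u v, ∃ x : ℕ, x < Fintype.card W ^ 2 ∧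
      2 * (x : ℤ) = R (φ u) (φ v) + ((2 * r) ^ 2 - 1) := by
    intro u v
    obtain ⟨⟨y, hy⟩, h2⟩ := hR (φ u) (φ u).2 (φ v) (φ v).2
    rw [abs_lt] at h2
    have e : ((2 * r) ^ 2 : ℤ) = 4 * r * r := by ring
    rw [hW]
    refine ⟨(y + 2 * r * r).toNat, ?_, ?_⟩
    · zify
      rw [e, Int.toNat_of_nonneg (by linarith)]
      linarith
    · rw [Int.toNat_of_nonneg (by linarith), e, hy]
      ring
  choose S hS1 hS2 using key
  have hR0 : ∀ g : ℕ → ℤ, ∑ u, g (φ u) = ∑ a ∈ range (2 * r), g a := fun g => by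
    rw [← Fin.sum_univ_eq_sum_range, ← Equiv.sum_comp φ]
  have hrow : ∀ u, ∑ v, R (φ u) (φ v) = 0 := fun u => by
    rw [hR0 (R (φ u)), sum_range_two_mul, sum_eq_zero fun v _ => Rrow _ v]
  have hcol : ∀ v, ∑ u, R (φ u) (φ v) = 0 := fun v => by
    rw [hR0 (fun a => R a (φ v)), Rcol]
  have hcast : (((2 * r) ^ 2 - 1 : ℕ) : ℤ) = (2 * r) ^ 2 - 1 := by
    push_cast [Nat.one_le_pow 2 (2 * r) (by omega)]
    ring
  have two : (2 : ℤ) ≠ 0 := by norm_num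
  refine ⟨S, r * ((2 * r) ^ 2 - 1), hS1, ?_, ?_, ?_⟩
  · intro u v u' v' h
    have h1 := hS2 u v
    have h2 := hS2 u' v'
    rw [h] at h1
    obtain ⟨h3, h4⟩ := Rinj (φ u) (φ u).2 (φ v) (φ v).2 (φ u') (φ u').2 (φ v') (φ v').2
      (by linarith)
    exact ⟨φ.injective (Fin.ext h3), φ.injective (Fin.ext h4)⟩
  · intro v
    zify
    apply mul_left_cancel₀ two
    rw [hcast, mul_sum, sum_congr rfl (fun u _ => hS2 u v), sum_add_distrib, hcol, sum_const,
      card_univ, hW, nsmul_eq_mul]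
    push_cast
    ring
  · intro u
    zify
    apply mul_left_cancel₀ two
    rw [hcast, mul_sum, sum_congr rfl (fun v _ => hS2 u v), sum_add_distrib, hrow, sum_const,
      card_univ, hW, nsmul_eq_mul]
    push_cast
    ring

/-! ### Labelings from a parametrization of the edges -/

/-- An enumeration `src i — tgt i` of the edges of a graph turns an injective function `ℓ` on the
indices, with values in `[1, |I|]`, into a bijective edge labeling. -/
theorem exists_labeling_of_parametrization {V I : Type*} [Fintype V] [DecidableEq V] [Fintype I]
    {G : SimpleGraph V} {src tgt : I → V} {ℓ : I → ℕ} (hadj : ∀ i, G.Adj (src i) (tgt i))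
    (hinj : Function.Injective fun i => s(src i, tgt i))
    (hsurj : ∀ u v, G.Adj u v → ∃ i, s(src i, tgt i) = s(u, v))
    (hℓ : Function.Injective ℓ) (hr : ∀ i, ℓ i ∈ Set.Icc 1 (Fintype.card I)) :
    ∃ f : Sym2 V → ℕ, Set.BijOn f G.edgeSet (Set.Icc 1 G.edgeSet.ncard) ∧
      ∀ v, vertexLabel G f v =
        ∑ i, ((if src i = v then ℓ i else 0) + if tgt i = v then ℓ i else 0) := by
  classical
  set ε : I → Sym2 V := fun i => s(src i, tgt i) with hε
  have hrange : G.edgeSet = Set.range ε := by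
    ext z
    induction z using Sym2.ind with
    | _ u v =>
      refine ⟨fun h => hsurj u v h, ?_⟩
      rintro ⟨i, hi⟩
      rw [← hi]
      exact hadj i
  have hcard : G.edgeSet.ncard = Fintype.card I := by
    rw [hrange, ← Set.image_univ, Set.ncard_image_of_injective _ hinj, Set.ncard_univ,
      Nat.card_eq_fintype_card]
  have hf : ∀ i, Function.extend ε ℓ 0 (ε i) = ℓ i := fun i => hinj.extend_apply ℓ 0 i
  refine ⟨Function.extend ε ℓ 0, ?_, ?_⟩
  · rw [hcard, hrange]
    have hmaps : Set.MapsTo (Function.extend ε ℓ 0) (Set.range ε) (Set.Icc 1 (Fintype.card I)) := by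
      rintro _ ⟨i, rfl⟩
      rw [hf]
      exact hr i
    have hinjOn : Set.InjOn (Function.extend ε ℓ 0) (Set.range ε) := by
      rintro _ ⟨i, rfl⟩ _ ⟨j, rfl⟩ h
      rw [hf, hf] at h
      rw [hℓ h]
    refine ⟨hmaps, hinjOn, ?_⟩
    have h1 : Function.extend ε ℓ 0 '' Set.range ε = Set.Icc 1 (Fintype.card I) := by
      apply Set.eq_of_subset_of_ncard_le hmaps.image_subset
      rw [hinjOn.ncard_image, ← hrange, hcard]
      simp [Set.ncard_eq_toFinset_card']
    exact h1.ge
  · intro v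
    have h1 : G.incidenceFinset v = (univ.filter fun i => v ∈ ε i).image ε := by
      ext z
      simp only [SimpleGraph.mem_incidenceFinset, SimpleGraph.incidenceSet, Set.mem_ofPred_eq,
        mem_image, mem_filter, mem_univ, true_and]
      rw [hrange]
      constructor
      · rintro ⟨⟨i, rfl⟩, h⟩
        exact ⟨i, h, rfl⟩
      · rintro ⟨i, h, rfl⟩
        exact ⟨⟨i, rfl⟩, h⟩
    have h2 : vertexLabel G (Function.extend ε ℓ 0) v =
        ∑ e ∈ (univ.filter fun i => v ∈ ε i).image ε, Function.extend ε ℓ 0 e := by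
      rw [← h1, vertexLabel]
      congr!
    rw [h2, sum_image fun i _ j _ h => hinj h, sum_filter]
    refine sum_congr rfl fun i _ => ?_
    rw [hf]
    have hne := (hadj i).ne
    by_cases ha : src i = v
    · have hb : tgt i ≠ v := fun h => hne (ha.trans h.symm)
      simp [hε, ha, hb]
    · by_cases hb : tgt i = v
      · simp [hε, ha, hb]
      · simp [hε, ha, hb, Ne.symm ha, Ne.symm hb]

/-! ### Adjacency in the factors -/

theorem coe_finRotate_eq_mod {k : ℕ} (i : Fin k) : (finRotate k i : ℕ) = (i + 1) % k := by
  cases k with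
  | zero => exact i.elim0
  | succ k => rw [finRotate_apply, Fin.val_add]; simp

theorem coe_finRotate_symm_eq_mod {k : ℕ} (i : Fin k) :
    ((finRotate k).symm i : ℕ) = (i + (k - 1)) % k := by
  have hk : 0 < k := i.pos
  have : (finRotate k).symm i = ⟨(i + (k - 1)) % k, Nat.mod_lt _ hk⟩ := by
    rw [Equiv.symm_apply_eq]
    apply Fin.ext
    rw [coe_finRotate_eq_mod, Nat.mod_add_mod, show (i : ℕ) + (k - 1) + 1 = i + k by omega,
      Nat.add_mod_right, Nat.mod_eq_of_lt i.2]
  rw [this]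

theorem cycleGraph_adj_iff_finRotate {k : ℕ} (hk : 2 ≤ k) (u v : Fin k) :
    (SimpleGraph.cycleGraph k).Adj u v ↔ v = finRotate k u ∨ u = finRotate k v := by
  obtain ⟨k, rfl⟩ : ∃ j, k = j + 2 := ⟨k - 2, by omega⟩
  rw [SimpleGraph.cycleGraph_adj, finRotate_apply, finRotate_apply, sub_eq_iff_eq_add,
    sub_eq_iff_eq_add, add_comm 1, add_comm 1, or_comm]

theorem cycleJoinNull_adj_inl_inl {k l : ℕ} (hk : 2 ≤ k) (i j : Fin k) :
    (cycleJoinNull k l).Adj (Sum.inl i) (Sum.inl j) ↔ j = finRotate k i ∨ i = finRotate k j := by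
  rw [← cycleGraph_adj_iff_finRotate hk]
  simp [cycleJoinNull, join]

theorem cycleJoinNull_adj_inl_inr {k l : ℕ} (i : Fin k) (j : Fin l) :
    (cycleJoinNull k l).Adj (Sum.inl i) (Sum.inr j) := by
  simp [cycleJoinNull, join]

theorem cycleJoinNull_not_adj_inr_inr {k l : ℕ} (i j : Fin l) :
    ¬(cycleJoinNull k l).Adj (Sum.inr i) (Sum.inr j) := by
  simp [cycleJoinNull, join]

theorem prism_adj (x y : Fin 3 × Fin 2) :
    prism.Adj x y ↔ (x.1 ≠ y.1 ∧ x.2 = y.2) ∨ (x.1 = y.1 ∧ x.2 ≠ y.2) := by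
  simp only [prism, SimpleGraph.cycleGraph_three_eq_top, SimpleGraph.boxProd_adj,
    SimpleGraph.top_adj]
  tauto

/-! ### A labeling of the prism with three vertex sums -/

/-- First end of the edge of the prism with label `e`. -/
def prismSrc : Fin 9 → Fin 3 × Fin 2 :=
  ![(0, 0), (2, 0), (0, 0), (1, 0), (0, 1), (1, 1), (1, 0), (0, 1), (0, 0)]

/-- Second end of the edge of the prism with label `e`. -/
def prismTgt : Fin 9 → Fin 3 × Fin 2 :=
  ![(0, 1), (2, 1), (1, 0), (1, 1), (2, 1), (2, 1), (2, 0), (1, 1), (2, 0)]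

/-- The sum of the labels, from `0` to `8`, of the edges of the prism at `x`. -/
def prismWeight (x : Fin 3 × Fin 2) : ℕ :=
  ∑ e : Fin 9, ((if prismSrc e = x then (e : ℕ) else 0) + if prismTgt e = x then (e : ℕ) else 0)

theorem prismWeight_mem (x : Fin 3 × Fin 2) : prismWeight x ∈ ({10, 11, 15} : Finset ℕ) := by
  revert x; decide

theorem prism_degree (x : Fin 3 × Fin 2) :
    ∑ e : Fin 9, ((if prismSrc e = x then 1 else 0) + if prismTgt e = x then 1 else 0) = 3 := by
  revert x; decide

theorem prism_adj_src_tgt (e : Fin 9) : prism.Adj (prismSrc e) (prismTgt e) := by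
  rw [prism_adj]; revert e; decide

theorem prismWeight_ne {x y : Fin 3 × Fin 2} (h : prism.Adj x y) :
    prismWeight x ≠ prismWeight y := by
  rw [prism_adj] at h; revert x y; decide

theorem exists_prism_edge {x y : Fin 3 × Fin 2} (h : prism.Adj x y) :
    ∃ e, (prismSrc e = x ∧ prismTgt e = y) ∨ (prismSrc e = y ∧ prismTgt e = x) := by
  rw [prism_adj] at h; revert x y; decide

theorem prism_edge_inj (e e' : Fin 9) (h : prismSrc e = prismSrc e') (h' : prismTgt e = prismTgt e') :
    e = e' := by
  revert e e'; decide

theorem prism_edge_ne_swap (e e' : Fin 9) (h : prismSrc e = prismTgt e') :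
    prismTgt e ≠ prismSrc e' := by
  revert e e'; decide

/-! ### The lower bound -/

theorem nine_le_localAntimagicChromaticNumber {m n : ℕ} (hm : 2 ≤ m) (hn : 1 ≤ n) :
    9 ≤ localAntimagicChromaticNumber (lexProd prism (cycleJoinNull (2 * m) (2 * n))) := by
  refine le_iInf₂ fun f hf => ?_
  have hz : 0 < 2 * m := by omega
  let w : Fin 3 → Fin (2 * m) ⊕ Fin (2 * n) :=
    ![Sum.inl ⟨0, hz⟩, Sum.inl (finRotate _ ⟨0, hz⟩), Sum.inr ⟨0, by omega⟩]
  have hw : ∀ i j, i ≠ j → (cycleJoinNull (2 * m) (2 * n)).Adj (w i) (w j) := by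
    have h01 : (cycleJoinNull (2 * m) (2 * n)).Adj (w 0) (w 1) :=
      (cycleJoinNull_adj_inl_inl (by omega) _ _).2 (Or.inl rfl)
    have h02 : (cycleJoinNull (2 * m) (2 * n)).Adj (w 0) (w 2) := cycleJoinNull_adj_inl_inr _ _
    have h12 : (cycleJoinNull (2 * m) (2 * n)).Adj (w 1) (w 2) := cycleJoinNull_adj_inl_inr _ _
    intro i j hij
    fin_cases i <;> fin_cases j
    exacts [absurd rfl hij, h01, h02, h01.symm, absurd rfl hij, h12, h02.symm, h12.symm,
      absurd rfl hij]
  have hinj : Function.Injective fun p : Fin 3 × Fin 3 =>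
      vertexLabel (lexProd prism (cycleJoinNull (2 * m) (2 * n))) f ((p.1, 0), w p.2) := by
    intro p q hpq
    by_contra hne
    refine hf.ne_of_adj ?_ hpq
    by_cases h1 : p.1 = q.1
    · exact Or.inr ⟨by rw [h1], hw _ _ fun h2 => hne (Prod.ext h1 h2)⟩
    · exact Or.inl ((prism_adj _ _).2 (Or.inl ⟨h1, rfl⟩))
  have h9 : (Set.range fun p : Fin 3 × Fin 3 => vertexLabel
      (lexProd prism (cycleJoinNull (2 * m) (2 * n))) f ((p.1, 0), w p.2)).ncard = 9 := by
    rw [← Set.image_univ, Set.ncard_image_of_injective _ hinj, Set.ncard_univ]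
    simp
  have hle : 9 ≤ numColors (lexProd prism (cycleJoinNull (2 * m) (2 * n))) f := by
    rw [← h9]
    refine Set.ncard_le_ncard ?_ (Set.finite_range _)
    rintro _ ⟨p, rfl⟩
    exact ⟨_, rfl⟩
  exact_mod_cast hle

/-! ### The edges of the product -/

/-- Index type of the edges of `G[H]`: the edges `(i, c)` of the copies of `H`, indexed as in
`exists_copies_labeling`, and those of the complete bipartite blocks over the edges of the prism. -/
abbrev ProdEdge (m n : ℕ) : Type :=
  (Fin 3 × Fin 2) × Fin (2 * m) × Fin (2 * n + 1) ⊕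
    Fin 9 × (Fin (2 * m) ⊕ Fin (2 * n)) × (Fin (2 * m) ⊕ Fin (2 * n))

/-- The vertices of `G[H]`. -/
abbrev ProdVertex (m n : ℕ) : Type := (Fin 3 × Fin 2) × (Fin (2 * m) ⊕ Fin (2 * n))

/-- The second end of the edge `(i, c)` of `H`, whose first end is the rim vertex `i`. -/
def copyTgt {m n : ℕ} (i : Fin (2 * m)) (c : Fin (2 * n + 1)) : Fin (2 * m) ⊕ Fin (2 * n) :=
  Fin.cases (Sum.inl (finRotate _ i)) Sum.inr c

/-- The first end of an edge of `G[H]`. -/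
def edgeSrc {m n : ℕ} : ProdEdge m n → ProdVertex m n
  | Sum.inl (x, i, _) => (x, Sum.inl i)
  | Sum.inr (e, u, _) => (prismSrc e, u)

/-- The second end of an edge of `G[H]`. -/
def edgeTgt {m n : ℕ} : ProdEdge m n → ProdVertex m n
  | Sum.inl (x, i, c) => (x, copyTgt i c)
  | Sum.inr (e, _, v) => (prismTgt e, v)

theorem edgeSrc_adj_edgeTgt {m n : ℕ} (hm : 2 ≤ m) (ε : ProdEdge m n) :
    (lexProd prism (cycleJoinNull (2 * m) (2 * n))).Adj (edgeSrc ε) (edgeTgt ε) := by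
  rcases ε with ⟨x, i, c⟩ | ⟨e, u, v⟩
  · refine Or.inr ⟨rfl, ?_⟩
    refine Fin.cases ?_ (fun j => ?_) c
    · exact (cycleJoinNull_adj_inl_inl (by omega) _ _).2 (Or.inl rfl)
    · exact cycleJoinNull_adj_inl_inr i j
  · exact Or.inl (prism_adj_src_tgt e)

theorem exists_edge_of_adj {m n : ℕ} (hm : 2 ≤ m) (u v : ProdVertex m n)
    (h : (lexProd prism (cycleJoinNull (2 * m) (2 * n))).Adj u v) :
    ∃ ε : ProdEdge m n, s(edgeSrc ε, edgeTgt ε) = s(u, v) := by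
  obtain ⟨x, u⟩ := u
  obtain ⟨y, v⟩ := v
  rcases h with h | ⟨h, h'⟩
  · obtain ⟨e, ⟨h1, h2⟩ | ⟨h1, h2⟩⟩ := exists_prism_edge h
    · exact ⟨Sum.inr (e, u, v), by simp only [edgeSrc, edgeTgt, h1, h2]⟩
    · exact ⟨Sum.inr (e, v, u), by simp only [edgeSrc, edgeTgt, h1, h2]; exact Sym2.eq_swap⟩
  · obtain rfl : x = y := h
    rcases u with i | i <;> rcases v with j | j
    · rcases (cycleJoinNull_adj_inl_inl (by omega) i j).1 h' with rfl | rfl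
      · exact ⟨Sum.inl (x, i, 0), rfl⟩
      · exact ⟨Sum.inl (x, j, 0), Sym2.eq_swap⟩
    · exact ⟨Sum.inl (x, i, j.succ), rfl⟩
    · exact ⟨Sum.inl (x, j, i.succ), Sym2.eq_swap⟩
    · exact absurd h' (cycleJoinNull_not_adj_inr_inr i j)

theorem copyTgt_inj {m n : ℕ} {i : Fin (2 * m)} {c c' : Fin (2 * n + 1)}
    (h : copyTgt i c = copyTgt i c') : c = c' := by
  induction c using Fin.cases <;> induction c' using Fin.cases <;> simp_all [copyTgt]

/-- No edge of `H` is listed once from each end: this would need `i + 2 = i` on the rim. -/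
theorem copyTgt_ne_swap {m n : ℕ} (hm : 2 ≤ m) {i i' : Fin (2 * m)} {c c' : Fin (2 * n + 1)}
    (h : Sum.inl i = copyTgt i' c') : copyTgt i c ≠ Sum.inl i' := by
  intro h'
  induction c using Fin.cases <;> induction c' using Fin.cases <;>
    simp [copyTgt, -finRotate_apply] at h h'
  have h1 := congrArg Fin.val h
  have h2 := congrArg Fin.val h'
  rw [coe_finRotate_eq_mod] at h1 h2
  rw [h1, Nat.mod_add_mod] at h2
  have := i'.2
  rcases Nat.lt_or_ge ((i' : ℕ) + 1 + 1) (2 * m) with h3 | h3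
  · rw [Nat.mod_eq_of_lt h3] at h2
    omega
  · rw [Nat.mod_eq_sub_mod h3, Nat.mod_eq_of_lt (by omega)] at h2
    omega

theorem edge_injective {m n : ℕ} (hm : 2 ≤ m) :
    Function.Injective fun ε : ProdEdge m n => s(edgeSrc ε, edgeTgt ε) := by
  have hne : ∀ e, prismSrc e ≠ prismTgt e := fun e => (prism_adj_src_tgt e).ne
  rintro (⟨x, i, c⟩ | ⟨e, u, v⟩) (⟨x', i', c'⟩ | ⟨e', u', v'⟩) h <;>
    simp only [edgeSrc, edgeTgt, Sym2.eq_iff, Prod.mk.injEq] at h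
  · rcases h with ⟨⟨rfl, h1⟩, -, h2⟩ | ⟨⟨rfl, h1⟩, -, h2⟩
    · obtain rfl := Sum.inl_injective h1
      rw [copyTgt_inj h2]
    · exact absurd h2 (copyTgt_ne_swap hm h1)
  · exfalso
    rcases h with ⟨⟨h1, -⟩, h2, -⟩ | ⟨⟨h1, -⟩, h2, -⟩
    · exact hne e' (h1.symm.trans h2)
    · exact hne e' (h2.symm.trans h1)
  · exfalso
    rcases h with ⟨⟨h1, -⟩, h2, -⟩ | ⟨⟨h1, -⟩, h2, -⟩
    · exact hne e (h1.trans h2.symm)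
    · exact hne e (h1.trans h2.symm)
  · rcases h with ⟨⟨h1, rfl⟩, h2, rfl⟩ | ⟨⟨h1, -⟩, h2, -⟩
    · rw [prism_edge_inj e e' h1 h2]
    · exact absurd h2 (prism_edge_ne_swap e e' h1)

/-! ### The labeling and its vertex sums -/

/-- Numbering of the six vertices of the prism. -/
def prismIndex (x : Fin 3 × Fin 2) : ℕ := 2 * x.1 + x.2

theorem prismIndex_lt (x : Fin 3 × Fin 2) : prismIndex x < 6 := by revert x; decide

theorem prismIndex_inj {x y : Fin 3 × Fin 2} (h : prismIndex x = prismIndex y) : x = y := by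
  revert x y; decide

/-- The labeling of `G[H]` made of a labeling `g` of the copies of `H` and a square `S`. -/
def edgeLabel {m n : ℕ} (g : ℕ → ℕ → ℕ → ℕ)
    (S : Fin (2 * m) ⊕ Fin (2 * n) → Fin (2 * m) ⊕ Fin (2 * n) → ℕ) : ProdEdge m n → ℕ
  | Sum.inl (x, i, c) => g (prismIndex x) i c
  | Sum.inr (e, u, v) => 12 * m * (2 * n + 1) + (2 * m + 2 * n) ^ 2 * e + S u v + 1

/-- The sum of `ℓ` over the edges of `G[H]` at `v`. -/
def edgeSum {m n : ℕ} (ℓ : ProdEdge m n → ℕ) (v : ProdVertex m n) : ℕ :=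
  ∑ ε, ((if edgeSrc ε = v then ℓ ε else 0) + if edgeTgt ε = v then ℓ ε else 0)

/-- The sum of the labels `g t` over the edges of `H` at a vertex. The rim vertex `i` lies on the rim
edges `i - 1` and `i`. -/
def copySum {m n : ℕ} (g : ℕ → ℕ → ℕ → ℕ) (t : ℕ) : Fin (2 * m) ⊕ Fin (2 * n) → ℕ
  | Sum.inl i => g t ((i + (2 * m - 1)) % (2 * m)) 0 + ∑ c ∈ range (2 * n + 1), g t i c
  | Sum.inr j => ∑ i ∈ range (2 * m), g t i (j + 1)

theorem sum_copy {m n : ℕ} (h : Fin (2 * m) → Fin (2 * n + 1) → ℕ)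
    (w : Fin (2 * m) ⊕ Fin (2 * n)) :
    ∑ i, ∑ c, ((if (Sum.inl i : Fin (2 * m) ⊕ Fin (2 * n)) = w then h i c else 0) +
      if copyTgt i c = w then h i c else 0) =
    match w with
    | Sum.inl i => h ((finRotate _).symm i) 0 + ∑ c, h i c
    | Sum.inr j => ∑ i, h i j.succ := by
  rcases w with i | j
  · have e : ∀ k, ∑ c, (if copyTgt k c = (Sum.inl i : Fin (2 * m) ⊕ Fin (2 * n)) then h k c else 0) =
        if k = (finRotate _).symm i then h k 0 else 0 := fun k => by
      rw [Fin.sum_univ_succ]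
      simp [copyTgt, Equiv.eq_symm_apply, -finRotate_apply, -finRotate_symm_apply]
    simp only [sum_add_distrib, e, Sum.inl.injEq]
    rw [sum_comm]
    simp [add_comm, -finRotate_symm_apply]
  · simp [copyTgt, Fin.sum_univ_succ]

theorem sum_triple {A B C : Type*} [Fintype A] [Fintype B] [Fintype C] (F : A × B × C → ℕ) :
    ∑ p, F p = ∑ a, ∑ b, ∑ c, F (a, b, c) := by
  simp only [Fintype.sum_prod_type]

theorem edgeSum_edgeLabel {m n : ℕ} (g : ℕ → ℕ → ℕ → ℕ)
    {S : Fin (2 * m) ⊕ Fin (2 * n) → Fin (2 * m) ⊕ Fin (2 * n) → ℕ} {K : ℕ}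
    (hcol : ∀ v, ∑ u, S u v = K) (hrow : ∀ u, ∑ v, S u v = K)
    (x : Fin 3 × Fin 2) (w : Fin (2 * m) ⊕ Fin (2 * n)) :
    edgeSum (edgeLabel g S) (x, w) = copySum g (prismIndex x) w +
      3 * ((2 * m + 2 * n) * (12 * m * (2 * n + 1) + 1) + K) +
      (2 * m + 2 * n) ^ 3 * prismWeight x := by
  have hcopy : ∑ y : Fin 3 × Fin 2, ∑ i : Fin (2 * m), ∑ c : Fin (2 * n + 1),
      ((if ((y, Sum.inl i) : ProdVertex m n) = (x, w) then g (prismIndex y) i c else 0) +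
        if ((y, copyTgt i c) : ProdVertex m n) = (x, w) then g (prismIndex y) i c else 0) =
      copySum g (prismIndex x) w := by
    rw [sum_eq_single x]
    · simp only [Prod.mk.injEq, true_and]
      rw [sum_copy (fun i c => g (prismIndex x) i c)]
      rcases w with i | j
      · simp only [copySum, coe_finRotate_symm_eq_mod,
          Fin.sum_univ_eq_sum_range (fun c => g (prismIndex x) i c)]
        rfl
      · simp only [copySum, Fin.val_succ,
          Fin.sum_univ_eq_sum_range (fun i => g (prismIndex x) i (j + 1))]
    · intro y _ hy
      simp [hy]
    · simp
  have hB1 : ∀ e : Fin 9, ∑ v, (12 * m * (2 * n + 1) + (2 * m + 2 * n) ^ 2 * e + S w v + 1) =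
      ((2 * m + 2 * n) * (12 * m * (2 * n + 1) + 1) + K) + (2 * m + 2 * n) ^ 3 * e := fun e => by
    simp only [sum_add_distrib, hrow, sum_const, card_univ, Fintype.card_sum, Fintype.card_fin,
      smul_eq_mul]
    ring
  have hB2 : ∀ e : Fin 9, ∑ u, (12 * m * (2 * n + 1) + (2 * m + 2 * n) ^ 2 * e + S u w + 1) =
      ((2 * m + 2 * n) * (12 * m * (2 * n + 1) + 1) + K) + (2 * m + 2 * n) ^ 3 * e := fun e => by
    simp only [sum_add_distrib, hcol, sum_const, card_univ, Fintype.card_sum, Fintype.card_fin,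
      smul_eq_mul]
    ring
  have hblock : ∀ e : Fin 9, ∑ u, ∑ v,
      ((if ((prismSrc e, u) : ProdVertex m n) = (x, w)
          then 12 * m * (2 * n + 1) + (2 * m + 2 * n) ^ 2 * e + S u v + 1 else 0) +
        if ((prismTgt e, v) : ProdVertex m n) = (x, w)
          then 12 * m * (2 * n + 1) + (2 * m + 2 * n) ^ 2 * e + S u v + 1 else 0) =
      ((2 * m + 2 * n) * (12 * m * (2 * n + 1) + 1) + K) *
        ((if prismSrc e = x then 1 else 0) + if prismTgt e = x then 1 else 0) +
      (2 * m + 2 * n) ^ 3 *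
        ((if prismSrc e = x then (e : ℕ) else 0) + if prismTgt e = x then (e : ℕ) else 0) := by
    intro e
    simp only [sum_add_distrib (f := fun v => ite _ _ _)]
    rw [sum_add_distrib]
    have e1 : ∑ u, ∑ v, (if ((prismSrc e, u) : ProdVertex m n) = (x, w)
          then 12 * m * (2 * n + 1) + (2 * m + 2 * n) ^ 2 * e + S u v + 1 else 0) =
        if prismSrc e = x then
          ((2 * m + 2 * n) * (12 * m * (2 * n + 1) + 1) + K) + (2 * m + 2 * n) ^ 3 * e else 0 := by
      rw [sum_eq_single w (fun u _ hu => by simp [hu]) (by simp), ← hB1]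
      by_cases h : prismSrc e = x <;> simp [h]
    have e2 : ∑ u, ∑ v, (if ((prismTgt e, v) : ProdVertex m n) = (x, w)
          then 12 * m * (2 * n + 1) + (2 * m + 2 * n) ^ 2 * e + S u v + 1 else 0) =
        if prismTgt e = x then
          ((2 * m + 2 * n) * (12 * m * (2 * n + 1) + 1) + K) + (2 * m + 2 * n) ^ 3 * e else 0 := by
      rw [sum_comm, sum_eq_single w (fun u _ hu => by simp [hu]) (by simp), ← hB2]
      by_cases h : prismTgt e = x <;> simp [h]
    rw [e1, e2]
    split_ifs <;> ring
  rw [edgeSum, Fintype.sum_sum_type, sum_triple, sum_triple]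
  refine (congrArg₂ (· + ·) hcopy (sum_congr rfl fun e _ => hblock e)).trans ?_
  rw [sum_add_distrib, ← mul_sum, ← mul_sum, prism_degree, ← prismWeight]
  ring

theorem card_prodEdge (m n : ℕ) : Fintype.card (ProdEdge m n) =
    6 * (2 * m * (2 * n + 1)) + 9 * (2 * m + 2 * n) ^ 2 := by
  simp [ProdEdge]
  ring

/-! ### The upper bound -/

/-- The proper coloring of `H` by the even rim vertices, the odd ones, and the null vertices. -/
def vertexClass {m n : ℕ} : Fin (2 * m) ⊕ Fin (2 * n) → Fin 3
  | Sum.inl i => if (i : ℕ) % 2 = 0 then 0 else 1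
  | Sum.inr _ => 2

theorem vertexClass_ne {m n : ℕ} (hm : 2 ≤ m) {u v : Fin (2 * m) ⊕ Fin (2 * n)}
    (h : (cycleJoinNull (2 * m) (2 * n)).Adj u v) : vertexClass u ≠ vertexClass v := by
  have key : ∀ i : Fin (2 * m), vertexClass (n := n) (Sum.inl i) ≠
      vertexClass (n := n) (Sum.inl (finRotate _ i)) := by
    intro i
    have : ((finRotate _ i : Fin (2 * m)) : ℕ) % 2 = (i + 1) % 2 := by
      rw [coe_finRotate_eq_mod, Nat.mod_mul_right_mod]
    simp only [vertexClass, this]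
    split_ifs <;> omega
  have key2 : ∀ (i : Fin (2 * m)) (j : Fin (2 * n)),
      vertexClass (n := n) (Sum.inl i) ≠ vertexClass (m := m) (Sum.inr j) := by
    intro i j
    simp only [vertexClass]
    split_ifs <;> decide
  rcases u with i | i <;> rcases v with j | j
  · rcases (cycleJoinNull_adj_inl_inl (by omega) i j).1 h with rfl | rfl
    · exact key i
    · exact (key j).symm
  · exact key2 i j
  · exact (key2 j i).symm
  · exact absurd h (cycleJoinNull_not_adj_inr_inr i j)

/-- Twice the sum of the labels of the edges of `H` at a vertex of the given class. -/
def classSum (m n : ℕ) : Fin 3 → ℤ :=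
  ![12 + (2 * n + 2) * (12 * m * (2 * n + 1) + 1), -12 + (2 * n + 2) * (12 * m * (2 * n + 1) + 1),
    2 * m * (12 * m * (2 * n + 1) + 1)]

/-- The sums within a copy differ by too little to make up for different weights of the copies. Up to
lower terms the largest difference is `|n + 1 - m| · 48mn`, against `16(m + n)³`. -/
theorem abs_classSum_sub_lt {m n : ℕ} (hm : 2 ≤ m) (hn : 1 ≤ n) (a b : Fin 3) :
    |classSum m n a - classSum m n b| < 2 * (2 * m + 2 * n) ^ 3 := by
  have hm' : (2 : ℤ) ≤ m := by exact_mod_cast hm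
  have hn' : (1 : ℤ) ≤ n := by exact_mod_cast hn
  have big : (24 : ℤ) < 2 * (2 * m + 2 * n) ^ 3 := by
    have : (6 : ℤ) ^ 3 ≤ (2 * m + 2 * n) ^ 3 := pow_le_pow_left₀ (by norm_num) (by linarith) 3
    linarith
  have main : |((2 * n + 2 - 2 * m) * (12 * m * (2 * n + 1) + 1) : ℤ)| + 12 <
      2 * (2 * m + 2 * n) ^ 3 := by
    rw [← lt_sub_iff_add_lt, abs_lt]
    rcases le_total (m : ℤ) (n + 1) with h | h
    -- In terms of the gap `k` between `m` and `n + 1` all coefficients become nonnegative.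
    · obtain ⟨x, hx⟩ : ∃ x : ℕ, (m : ℤ) = x + 2 := ⟨m - 2, by omega⟩
      obtain ⟨k, hk⟩ : ∃ k : ℕ, (n : ℤ) = m - 1 + k := ⟨n + 1 - m, by omega⟩
      rw [hk, hx] at big ⊢
      constructor
      · have : (0 : ℤ) ≤ (2 * (x + 2 - 1 + k) + 2 - 2 * (x + 2)) *
            (12 * (x + 2) * (2 * (x + 2 - 1 + k) + 1) + 1) := by ring_nf; positivity
        linarith
      · rw [← sub_pos]
        ring_nf
        positivity
    · obtain ⟨y, hy⟩ : ∃ y : ℕ, (n : ℤ) = y + 1 := ⟨n - 1, by omega⟩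
      obtain ⟨k, hk⟩ : ∃ k : ℕ, (m : ℤ) = n + 1 + k := ⟨m - n - 1, by omega⟩
      rw [hk, hy]
      constructor
      · rw [← sub_pos]
        ring_nf
        positivity
      · rw [← sub_pos]
        ring_nf
        positivity
  obtain ⟨h1, h2⟩ := abs_lt.1 (lt_sub_iff_add_lt.2 main)
  generalize hN : (2 * (2 * m + 2 * n) ^ 3 : ℤ) = N at big h1 h2 ⊢
  fin_cases a <;> fin_cases b <;> simp only [classSum] <;> rw [abs_lt] <;> constructor <;>
    simp <;> linarith

theorem classSum_injective {m n : ℕ} (hm : 2 ≤ m) : Function.Injective (classSum m n) := by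
  have hm' : (2 : ℤ) ≤ m := by exact_mod_cast hm
  have hq : (24 : ℤ) ≤ 12 * m * (2 * n + 1) := by nlinarith [Int.natCast_nonneg n]
  have key : ∀ s : ℤ, s = 12 ∨ s = -12 →
      s + (2 * n + 2) * (12 * m * (2 * n + 1) + 1) ≠ 2 * m * (12 * m * (2 * n + 1) + 1) := by
    intro s hs h
    generalize (12 * m * (2 * n + 1) : ℤ) = q at hq h
    rcases lt_trichotomy (m : ℤ) (n + 1) with h' | h' | h'
    · have : (m : ℤ) + 1 ≤ n + 1 := h'
      rcases hs with rfl | rfl <;> nlinarith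
    · rw [h'] at h
      rcases hs with rfl | rfl <;> linarith
    · have : (n : ℤ) + 1 + 1 ≤ m := h'
      rcases hs with rfl | rfl <;> nlinarith
  have k1 := key 12 (Or.inl rfl)
  have k2 := key (-12) (Or.inr rfl)
  intro a b h
  fin_cases a <;> fin_cases b <;> simp only [classSum] at h <;> simp at h ⊢
  · exact k1 h
  · exact k2 h
  · exact k1 h.symm
  · exact k2 h.symm

theorem two_mul_copySum {m n : ℕ} {g : ℕ → ℕ → ℕ → ℕ} {t : ℕ}
    (hrim : ∀ i < 2 * m, 2 * ((g t ((i + (2 * m - 1)) % (2 * m)) 0 +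
      ∑ c ∈ range (2 * n + 1), g t i c : ℕ) : ℤ) =
        12 * (-1) ^ i + (2 * n + 2) * (12 * m * (2 * n + 1) + 1))
    (hhub : ∀ c < 2 * n + 1, c ≠ 0 → 2 * ((∑ i ∈ range (2 * m), g t i c : ℕ) : ℤ) =
      2 * m * (12 * m * (2 * n + 1) + 1)) (w : Fin (2 * m) ⊕ Fin (2 * n)) :
    2 * (copySum g t w : ℤ) = classSum m n (vertexClass w) := by
  rcases w with i | j
  · rw [copySum, hrim i i.2]
    simp only [vertexClass]
    split_ifs with h
    · rw [(Nat.even_iff.2 h).neg_one_pow]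
      simp [classSum]
    · rw [(Nat.odd_iff.2 (by omega)).neg_one_pow]
      simp [classSum]
  · rw [copySum, hhub _ (by omega) (by omega)]
    simp [classSum, vertexClass]

theorem localAntimagicChromaticNumber_le_nine {m n : ℕ} (hm : 2 ≤ m) (hn : 1 ≤ n) :
    localAntimagicChromaticNumber (lexProd prism (cycleJoinNull (2 * m) (2 * n))) ≤ 9 := by
  obtain ⟨g, hg, ginj, grim, ghub⟩ := exists_copies_natLabeling hm hn
  have hcardW : Fintype.card (Fin (2 * m) ⊕ Fin (2 * n)) = 2 * m + 2 * n := by simp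
  obtain ⟨S, K, hS, Sinj, Scol, Srow⟩ :=
    exists_semimagic_square (Fin (2 * m) ⊕ Fin (2 * n)) (m + n) (by omega) (by rw [hcardW]; ring)
  rw [hcardW] at hS
  have hgr : ∀ x (i : Fin (2 * m)) (c : Fin (2 * n + 1)), 1 ≤ g (prismIndex x) i c ∧
      g (prismIndex x) i c ≤ 12 * m * (2 * n + 1) := fun x i c =>
    hg _ (prismIndex_lt x) i i.2 c c.2
  obtain ⟨f, hbij, hsum⟩ := exists_labeling_of_parametrization (ℓ := edgeLabel g S)
    (edgeSrc_adj_edgeTgt (n := n) hm) (edge_injective hm) (exists_edge_of_adj hm)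
    (by
      rintro (⟨x, i, c⟩ | ⟨e, u, v⟩) (⟨x', i', c'⟩ | ⟨e', u', v'⟩) h <;>
        simp only [edgeLabel] at h
      · obtain ⟨h1, h2, h3⟩ := ginj _ (prismIndex_lt x) i i.2 c c.2 _ (prismIndex_lt x') i' i'.2
          c' c'.2 h
        rw [prismIndex_inj h1, Fin.ext h2, Fin.ext h3]
      · have := hgr x i c
        omega
      · have := hgr x' i' c'
        omega
      · have hlt := hS u v
        have hlt' := hS u' v'
        have hpos : 0 < (2 * m + 2 * n) ^ 2 := by positivity
        have h' : S u v + (2 * m + 2 * n) ^ 2 * e = S u' v' + (2 * m + 2 * n) ^ 2 * e' := by omega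
        have he := congrArg (· / (2 * m + 2 * n) ^ 2) h'
        simp only [Nat.add_mul_div_left _ _ hpos, Nat.div_eq_of_lt hlt, Nat.div_eq_of_lt hlt',
          zero_add] at he
        obtain rfl := Fin.ext he
        obtain ⟨rfl, rfl⟩ := Sinj u v u' v' (by omega)
        rfl)
    (by
      intro ε
      rw [card_prodEdge]
      have e0 : 6 * (2 * m * (2 * n + 1)) = 12 * m * (2 * n + 1) := by ring
      rcases ε with ⟨x, i, c⟩ | ⟨e, u, v⟩
      · have := hgr x i c
        simp only [edgeLabel, Set.mem_Icc]
        omega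
      · have h1 := hS u v
        have h2 : (2 * m + 2 * n) ^ 2 * (e : ℕ) ≤ (2 * m + 2 * n) ^ 2 * 8 :=
          Nat.mul_le_mul_left _ (by omega)
        simp only [edgeLabel, Set.mem_Icc]
        omega)
  -- Twice `f⁺` is a sum of a function of the class in `H` and of the weight in the prism.
  have hlabel : ∀ x w, 2 * (vertexLabel (lexProd prism (cycleJoinNull (2 * m) (2 * n))) f
      (x, w) : ℤ) = classSum m n (vertexClass w) +
        6 * ((2 * m + 2 * n) * (12 * m * (2 * n + 1) + 1) + K) +
        2 * (2 * m + 2 * n) ^ 3 * prismWeight x := by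
    intro x w
    rw [hsum, ← edgeSum, edgeSum_edgeLabel g Scol Srow, ← two_mul_copySum
      (grim _ (prismIndex_lt x)) (ghub _ (prismIndex_lt x))]
    push_cast
    ring
  have hf : IsLocalAntimagicLabeling (lexProd prism (cycleJoinNull (2 * m) (2 * n))) f := by
    refine ⟨hbij, ?_⟩
    rintro ⟨x, u⟩ ⟨y, v⟩ hadj heq
    have hu := hlabel x u
    rw [heq, hlabel y v] at hu
    rcases hadj with h | ⟨h, h'⟩
    · have hne := prismWeight_ne h
      have hlt := abs_lt.1 (abs_classSum_sub_lt hm hn (vertexClass u) (vertexClass v))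
      have hpos : (0 : ℤ) < 2 * (2 * m + 2 * n) ^ 3 := by positivity
      generalize (2 * (2 * m + 2 * n) ^ 3 : ℤ) = N at hu hlt hpos
      rcases lt_or_gt_of_ne hne with h1 | h1
      · have : (prismWeight x : ℤ) + 1 ≤ prismWeight y := by exact_mod_cast h1
        nlinarith
      · have : (prismWeight y : ℤ) + 1 ≤ prismWeight x := by exact_mod_cast h1
        nlinarith
    · obtain rfl : x = y := h
      exact vertexClass_ne hm h' (classSum_injective hm (by linarith))
  have hcolors : numColors (lexProd prism (cycleJoinNull (2 * m) (2 * n))) f ≤ 9 := by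
    have hsub : Set.range (vertexLabel (lexProd prism (cycleJoinNull (2 * m) (2 * n))) f) ⊆
        (((({10, 11, 15} : Finset ℕ) ×ˢ (univ : Finset (Fin 3))).image fun p =>
          ((classSum m n p.2 + 6 * ((2 * m + 2 * n) * (12 * m * (2 * n + 1) + 1) + K) +
            2 * (2 * m + 2 * n) ^ 3 * p.1) / 2).toNat : Finset ℕ) : Set ℕ) := by
      rintro _ ⟨⟨x, w⟩, rfl⟩
      rw [mem_coe, mem_image]
      refine ⟨(prismWeight x, vertexClass w), ?_, ?_⟩
      · exact mem_product.2 ⟨prismWeight_mem x, mem_univ _⟩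
      · dsimp only
        rw [← hlabel x w]
        omega
    refine (Set.ncard_le_ncard hsub (finite_toSet _)).trans ?_
    rw [Set.ncard_coe_finset]
    exact card_image_le.trans (by simp)
  exact (iInf₂_le f hf).trans (by exact_mod_cast hcolors)

end LocalAntimagic

theorem mainTheorem4 (m n : ℕ) (hm : 2 ≤ m) (hn : 1 ≤ n) :
    LocalAntimagic.localAntimagicChromaticNumber
      (LocalAntimagic.lexProd LocalAntimagic.prism
        (LocalAntimagic.cycleJoinNull (2 * m) (2 * n))) = 9 :=
  le_antisymm (LocalAntimagic.localAntimagicChromaticNumber_le_nine hm hn)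
    (LocalAntimagic.nine_le_localAntimagicChromaticNumber hm hn)
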